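/- **Proposition 3.3.** Let $D\subset\mathbb R^2$ be a connected diagram of a link, with $n\ge 0$ crossings, a marked point $p$ on one of its edges, and its regions coloured black and white in checkerboard fashion. The two regions adjacent to $p$ (one black, one white) are called marked. A *Kauffman state* of $D$ is a choice, at every crossing $c$, of one of the four corners $x(c)$ at $c$, such that every unmarked region contains exactly one chosen corner and the marked regions contain none. The *black graph* has the black regions as vertices and one edge through every crossing, joining the regions of its two black corners; the *white graph* is defined in the same way. Let $T$ be a spanning tree of the black graph and $T^*$ the dual spanning tree of the white graph, so that through every crossing passes exactly one edge of $T\cup T^*$. Both trees are rooted at their marked regions. Let $\mathcal H_2(D,T)=(\Sigma,\alpha,\beta)$ be the following Heegaard diagram of genus $g=n+1$. The surface $\Sigma$ is the boundary of a regular neighbourhood of $D$ in $\mathbb R^3$; the plane of $D$ divides it into a top and a bottom half. The $\alpha$ curves are the intersections of $\Sigma$ with the regions of $D$ other than the marked white one. The $\beta$ curves are a meridian $\beta_p$ of the marked edge near $p$ and one curve $\beta_c$ for every crossing $c$. The curve $\beta_c$ consists of two arcs on the top, each crossing over one of the two halves of the understrand at $c$ and ending on $\Sigma\cap\mathbb R^2$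 in the two corners adjacent to it, and two arcs on the bottom, where $e$ denotes the edge of $T\cup T^*$ through $c$: the projection of the part of $e$ near $c$, which joins two opposite corners at $c$, and an arc which joins the other two corners by running once around that component of (the tree containing $e$) $-\,e$ which does not contain the root. The arcs on the bottom are drawn so that the $\beta$ curves are pairwise disjoint. Then the generators of $\widehat{CF}(\mathcal H_2(D,T))$, i.e. the points of $\mathbb T_\alpha\cap\mathbb T_\beta\subset \mathrm{Sym}^g(\Sigma)$, are in one-to-one correspondence with the Kauffman states of $D$. Explicitly, the Kauffman state $x$ corresponds to the unordered $g$-tuple consisting of the intersection point of $\beta_p$ with the $\alpha$ curve of the marked black region and, for every crossing $c$, the point of $\beta_c\cap\mathbb R^2$ in the corner $x(c)$. -/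

import Mathlib

/-! ## Marked link diagrams -/

/-- Half-edges of a marked link diagram with set of crossings `X`.  The marked point `p` is treated
as an additional vertex of valency two.  `Sum.inl (c, k)`, `k : ZMod 4`, are the four half-edges
at the crossing `c` in counterclockwise order, the even ones lying on the understrand and the odd
ones on the overstrand; `Sum.inr j`, `j : ZMod 2`, are the two half-edges at `p`. -/
abbrev Dart (X : Type*) : Type _ := (X × ZMod 4) ⊕ ZMod 2

/-- The next half-edge, counterclockwise, at the same vertex.  The half-edge `d` also names the
corner (sector) at its vertex which lies between `d` and `rot d`. -/
def rot (X : Type*) : Equiv.Perm (Dart X) :=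
  Equiv.sumCongr (Equiv.prodCongr (Equiv.refl X) (Equiv.addRight (1 : ZMod 4)))
    (Equiv.addRight (1 : ZMod 2))

/-- Walking along the boundary of a region, with the region on the left, one leaves the corner `d`
along the half-edge `d` and arrives along `flip d` at the corner between `rot⁻¹ (flip d)` and
`flip d`. The orbits of this permutation of the corners are the regions of the diagram. -/
def faceNext {X : Type*} (flip : Equiv.Perm (Dart X)) : Equiv.Perm (Dart X) :=
  flip.trans (rot X).symm

/-- A connected link diagram in the plane (up to planar isotopy, with the plane completed to the
sphere), with set of crossings `X`, a marked point `p` on one of its edges and a checkerboard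
colouring of its regions.  It is given as a combinatorial map of genus zero. -/
structure MarkedDiagram (X : Type*) [Fintype X] where
  /-- the other half of the same edge -/
  flip : Equiv.Perm (Dart X)
  flip_flip : ∀ d, flip (flip d) = d
  flip_ne : ∀ d, flip d ≠ d
  connected : ∀ d d' : Dart X, Relation.EqvGen (fun a b => b = rot X a ∨ b = flip a) d d'
  /-- Euler's formula: there are `|X| + 1` vertices (with `p`), `2 |X| + 1` edges, and the
  regions are the orbits of `faceNext flip`. -/
  euler : (Fintype.card X + 1) + Nat.card (Quotient (Equiv.Perm.SameCycle.setoid (faceNext flip)))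
    = (2 * Fintype.card X + 1) + 2
  /-- the colour of the region to which a corner belongs; `true` is black, `false` is white -/
  color : Dart X → Bool
  color_faceNext : ∀ d, color (faceNext flip d) = color d
  color_rot : ∀ d, color (rot X d) = !color d

namespace MarkedDiagram

variable {X : Type*} [Fintype X] (D : MarkedDiagram X)

/-- The regions of the diagram. -/
def Region : Type _ := Quotient (Equiv.Perm.SameCycle.setoid (faceNext D.flip))

/-- The region to which a corner belongs. -/
def region (d : Dart X) : D.Region := Quotient.mk _ d

instance : Finite D.Region := Quotient.finite _

/-- The corner at the marked point `p` which has colour `χ`. -/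
def rootCorner (χ : Bool) : Dart X :=
  if D.color (Sum.inr 0) = χ then Sum.inr 0 else Sum.inr 1

/-- The marked region of colour `χ`: the root `r_B` (for `true`) or `r_W` (for `false`). -/
def root (χ : Bool) : D.Region := D.region (D.rootCorner χ)

/-- A Kauffman state: a choice of one of the four corners at every crossing, such that every
unmarked region contains exactly one chosen corner and the marked regions contain none. -/
structure KauffmanState where
  /-- the corner `x(c)` paired with the crossing `c` -/
  corner : X → ZMod 4
  bijOn : Set.BijOn (fun c => D.region (Sum.inl (c, corner c))) Set.univ
    {R | R ≠ D.root true ∧ R ≠ D.root false}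

/-! ## Black and white graphs -/

/-- In the graph on the regions of colour `χ` which has one edge for every crossing, joining the two
opposite corners of colour `χ` there, two regions are connected by a path with edges in `F`. -/
def Joined (χ : Bool) (F : Set X) : D.Region → D.Region → Prop :=
  Relation.EqvGen fun R S => ∃ c ∈ F, ∃ k : ZMod 4, D.color (Sum.inl (c, k)) = χ ∧
    R = D.region (Sum.inl (c, k)) ∧ S = D.region (Sum.inl (c, k + 2))

/-- `T` is (the edge set of) a spanning tree of the black graph: it connects all the black
regions, and it contains no cycle, i.e. no edge of `T` has its ends connected by other edges. -/
structure IsSpanningTree (T : Set X) : Prop where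
  spanning : ∀ d d', D.color d = true → D.color d' = true →
    D.Joined true T (D.region d) (D.region d')
  acyclic : ∀ c ∈ T, ∀ k : ZMod 4, D.color (Sum.inl (c, k)) = true →
    ¬ D.Joined true (T \ {c}) (D.region (Sum.inl (c, k))) (D.region (Sum.inl (c, k + 2)))

/-- The edges of `T` for the colour black, those of the dual tree `T*` for the colour white. -/
def treeEdges (T : Set X) (χ : Bool) : Set X := {c | c ∈ T ↔ χ = true}

open Classical in
/-- The colour of the regions joined by the edge of `T ∪ T*` through the crossing `c`. -/
noncomputable def edgeColor (T : Set X) (c : X) : Bool := decide (c ∈ T)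

/-- The vertices of the subtree `T_e`: delete the edge `e` of `T ∪ T*` through the crossing `c` from
the tree to which it belongs and take the component which does not contain the root. -/
def farSide (T : Set X) (c : X) : Set D.Region :=
  {R | (∃ d, D.color d = edgeColor T c ∧ R = D.region d) ∧
    ¬ D.Joined (edgeColor T c) (treeEdges T (edgeColor T c) \ {c}) (D.root (edgeColor T c)) R}

/-! ## The Heegaard surface

Let `N` be a planar neighbourhood of the diagram, cut along the diagram into one collar for every
region, and cut the collars further at the midpoints of the edges into one rectangle for every
corner.  The boundary `Σ` of the three-dimensional neighbourhood is the double of `N`: two copies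
(top and bottom) of `N` glued along the boundary.  The two copies of the rectangle of a corner `d`
fit together to a square with coordinates `(t, h) ∈ [-1, 1]²`:
`h = 0` is the boundary of `N` (the plane of the diagram), `h > 0` is the top and `h < 0` the
bottom of `Σ`; `h = 1` lies above and `h = -1` below the diagram.  The coordinate `t` runs along the
boundary of the region: `t = 0` is the position of the vertex, `t ≥ 0` runs along the half-edge `d`
and `t ≤ 0` along the half-edge `rot d`, and `|t| = 1` are the midpoints of the edges. -/

/-- The disjoint union of the squares. -/
abbrev Squares (X : Type*) : Type _ := Dart X × Set.Icc (-1 : ℝ) 1 × Set.Icc (-1 : ℝ) 1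

instance : TopologicalSpace (Dart X) := ⊥

/-- Consecutive squares along a region are glued along `t = 1` and `t = -1`; the two squares to
either side of the half-edge `d` are glued along it, above (`h = 1`) and below (`h = -1`). -/
def Glue (a b : Squares X) : Prop :=
  (b.1 = faceNext D.flip a.1 ∧ (a.2.1 : ℝ) = 1 ∧ (b.2.1 : ℝ) = -1 ∧ b.2.2 = a.2.2) ∨
  (b.1 = (rot X).symm a.1 ∧ 0 ≤ (a.2.1 : ℝ) ∧ (b.2.1 : ℝ) = -(a.2.1 : ℝ) ∧
    b.2.2 = a.2.2 ∧ |(a.2.2 : ℝ)| = 1)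

/-- The Heegaard surface `Σ`. -/
def Surface : Type _ := Quot D.Glue

instance : TopologicalSpace D.Surface := inferInstanceAs (TopologicalSpace (Quot D.Glue))

/-- The point with coordinates `(t, h)` in the square of the corner `d`. -/
def pt (d : Dart X) (t h : Set.Icc (-1 : ℝ) 1) : D.Surface := Quot.mk _ (d, t, h)

/-- The point of `Σ` in the plane of the diagram in the middle of the corner `d`. -/
def cornerPoint (d : Dart X) : D.Surface := D.pt d ⟨0, by norm_num⟩ ⟨0, by norm_num⟩

/-- The genus of `Σ`. -/
def genus (_D : MarkedDiagram X) : ℕ := Fintype.card X + 1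

/-! ## The attaching curves -/

/-- The intersection of `Σ` with the region `R` of the plane. -/
def regionCurve (R : D.Region) : Set D.Surface :=
  {P | ∃ d t h, P = D.pt d t h ∧ (h : ℝ) = 0 ∧ D.region d = R}

/-- The `α` curves are indexed by the regions other than the marked white one. -/
abbrev AlphaIndex : Type _ := {R : D.Region // R ≠ D.root false}

noncomputable instance : Fintype D.AlphaIndex :=
  Fintype.ofFinite _

/-- The `α` curves. -/
def alphaCurve (R : D.AlphaIndex) : Set D.Surface := D.regionCurve R.1

/-- The meridian `β_p` which encircles the marked edge at `p`. -/
def meridian : Set D.Surface :=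
  {P | ∃ (j : ZMod 2) (t h : _), P = D.pt (Sum.inr j) t h ∧ (t : ℝ) = 0}

/-- The two `β` arcs on the top at the crossing `c`: each of them crosses over one of the two halves
`(c, 0)`, `(c, 2)` of the understrand and ends in the two corners adjacent to it. -/
def topArcs (c : X) : Set D.Surface :=
  {P | ∃ (k : ZMod 4) (t h : _), P = D.pt (Sum.inl (c, k)) t h ∧ (h : ℝ) = 2 * |(t : ℝ)| ∧
    (((k = 0 ∨ k = 2) ∧ 0 ≤ (t : ℝ)) ∨ ((k = 1 ∨ k = 3) ∧ (t : ℝ) ≤ 0))}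

/-- The projection to the bottom of the part near the crossing `c` of the edge of `T ∪ T*` through
`c`: it joins opposite corners of `c` and passes below the crossing. -/
def edgeArc (T : Set X) (c : X) : Set D.Surface :=
  {P | ∃ (k : ZMod 4) (t h : _), P = D.pt (Sum.inl (c, k)) t h ∧ (t : ℝ) = 0 ∧ (h : ℝ) ≤ 0 ∧
    D.color (Sum.inl (c, k)) = edgeColor T c}

/-- A number strictly between `1/2` and `1`, the smaller the larger the subtree `T_e` is. It fixes
the relative position of the parallel strands of different silhouettes. -/
noncomputable def level (T : Set X) (c : X) : ℝ := 1 / 2 + 1 / (2 * ((D.farSide T c).ncard + 2))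

/-- The silhouette on the bottom of `Σ` of the subtree `T_e`, where `e` is the edge of `T ∪ T*`
through the crossing `c`.  It starts at one of the two corners at `c` not met by `e`, goes once
around `T_e`, and ends at the other such corner.  It is the union of one piece for every corner
`b`, at a crossing `c'`, of a region `R ∈ T_e`; with `l = level T c`, and with `h + 1`
being the height above the bottom core of the surface, the piece is as follows.
If `c' = c`, it consists of the two ends of the arc: straight segments in the squares to either
side of `b`, from the corner points of these to height `l` at the midpoint of the edge.
If `c' ≠ c` and the edge through `c'` emanates from the corner `b`, then this edge belongs to
`T_e`, and the piece runs to either side of it, at height `l` in the squares to either side of `b`.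
Otherwise the edge of the other tree passes through `c'`, and the piece turns around the corner `b`:
it comes from height `l` in one neighbouring square, crosses below the diagram into the square
of `b` at distance `1 - l` from `c'`, and passes between `c'` and the corner point of `b`
in a symmetric way to the other neighbouring square. -/
def silhouette (T : Set X) (c : X) : Set D.Surface :=
  {P | ∃ (c' : X) (k : ZMod 4) (d : Dart X) (t h : Set.Icc (-1 : ℝ) 1),
    D.color (Sum.inl (c', k)) = edgeColor T c ∧ D.region (Sum.inl (c', k)) ∈ D.farSide T c ∧
    P = D.pt d t h ∧
    let side : Prop := (d = Sum.inl (c', k + 1) ∧ 0 ≤ (t : ℝ)) ∨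
      (d = Sum.inl (c', k - 1) ∧ (t : ℝ) ≤ 0)
    let l : ℝ := D.level T c
    ((c' = c ∧ side ∧ (h : ℝ) + 1 = 1 - (1 - l) * |(t : ℝ)|) ∨
      (c' ≠ c ∧ edgeColor T c' = edgeColor T c ∧ side ∧ (h : ℝ) + 1 = l) ∨
      (edgeColor T c' ≠ edgeColor T c ∧
        ((side ∧ 1 - l ≤ |(t : ℝ)| ∧ (h : ℝ) + 1 = |(t : ℝ)| - (1 - l)) ∨
          (d = Sum.inl (c', k) ∧ |(t : ℝ)| ≤ 1 - l ∧ (h : ℝ) + 1 = (1 - l) - |(t : ℝ)|))))}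

/-- The `β` curves: the meridian `β_p` (for `none`) and one curve for every crossing, made of
two arcs on the top and two arcs on the bottom. -/
def betaCurve (T : Set X) : Option X → Set D.Surface
  | none => D.meridian
  | some c => D.topArcs c ∪ D.edgeArc T c ∪ D.silhouette T c

end MarkedDiagram

/-! ## Generators of the Floer complex -/

/-- The image in the symmetric product `Sym^g(S)` of the product of a family of curves in `S`. -/
def symTorus {S ι : Type*} [Fintype ι] (g : ℕ) (γ : ι → Set S) : Set (Sym S g) :=
  {x | ∃ q : ι → S, (∀ i, q i ∈ γ i) ∧ (x : Multiset S) = Finset.univ.val.map q}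

namespace MarkedDiagram

variable {X : Type*} [Fintype X] (D : MarkedDiagram X)

/-- The torus `𝕋_α` in `Sym^g(Σ)`. -/
def torusAlpha : Set (Sym D.Surface D.genus) := symTorus D.genus D.alphaCurve

/-- The torus `𝕋_β` in `Sym^g(Σ)`. -/
def torusBeta (T : Set X) : Set (Sym D.Surface D.genus) := symTorus D.genus (D.betaCurve T)

/-- The generators of the Floer chain complex of the Heegaard diagram `(Σ, α, β)` built from the
diagram and the spanning tree `T` of its black graph: the points of `𝕋_α ∩ 𝕋_β`. -/
def generators (T : Set X) : Set (Sym D.Surface D.genus) := D.torusAlpha ∩ D.torusBeta T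

end MarkedDiagram

/-! The `α` curves lie in the plane `h = 0`, so every point of a generator does. The `β` curves meet
that plane only in corner points: `β_p` in the two corners at `p`, `β_c` in the four corners at `c`
(`eq_cornerPoint_of_mem_betaCurve_some`). A corner point lies on the curve of its own region and on
no other (`cornerPoint_mem_regionCurve_iff`). Hence a generator amounts to one corner at `p` and one
at each crossing whose regions run exactly once through all regions except the marked white one. The
corner at `p` is then the black one and occupies the marked black region; the other corners form a
Kauffman state. -/

namespace MarkedDiagram

variable {X : Type*} [Fintype X] (D : MarkedDiagram X)

/-! ## Points of the surface in the plane of the diagram -/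

/-- The coordinate `h`, which is compatible with the gluing of the squares. -/
def height : D.Surface → ℝ :=
  Quot.lift (fun a => (a.2.2 : ℝ)) fun a b hab => by
    rcases hab with ⟨-, -, -, h⟩ | ⟨-, -, -, h, -⟩ <;> simp [h]

lemma height_pt (d : Dart X) (t h : Set.Icc (-1 : ℝ) 1) : D.height (D.pt d t h) = h := rfl

/-- The middle of a corner is not glued to any other point. -/
lemma pt_eq_cornerPoint_iff {d d' : Dart X} {t h : Set.Icc (-1 : ℝ) 1} :
    D.pt d t h = D.cornerPoint d' ↔ d = d' ∧ (t : ℝ) = 0 ∧ (h : ℝ) = 0 := by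
  constructor
  · intro H
    -- This predicate descends to the quotient because glued points have `|t| = 1` or `|h| = 1`, so
    -- it is false on both sides of every gluing.
    let isMiddle : D.Surface → Prop :=
      Quot.lift (fun a => a.1 = d' ∧ (a.2.1 : ℝ) = 0 ∧ (a.2.2 : ℝ) = 0) fun a b hab => by
        rcases hab with ⟨-, ha, hb, -⟩ | ⟨-, -, -, hb, ha⟩
        · simp [ha, hb]
        · have h0 : (a.2.2 : ℝ) ≠ 0 := fun h0 => by simp [h0] at ha
          simp [hb, h0]
    have hm : isMiddle (D.cornerPoint d') := ⟨rfl, rfl, rfl⟩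
    rw [← H] at hm
    exact hm
  · rintro ⟨rfl, ht, hh⟩
    have ht' : t = ⟨0, by norm_num⟩ := Subtype.ext ht
    have hh' : h = ⟨0, by norm_num⟩ := Subtype.ext hh
    rw [ht', hh']
    rfl

lemma cornerPoint_injective : Function.Injective D.cornerPoint := fun _ _ h =>
  ((D.pt_eq_cornerPoint_iff).1 h).1

lemma cornerPoint_mem_regionCurve_iff {d : Dart X} {R : D.Region} :
    D.cornerPoint d ∈ D.regionCurve R ↔ D.region d = R := by
  constructor
  · rintro ⟨d', t, h, H, -, hR⟩
    rwa [← ((D.pt_eq_cornerPoint_iff).1 H.symm).1]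
  · intro hR
    exact ⟨d, _, _, rfl, rfl, hR⟩

lemma height_eq_zero_of_mem_regionCurve {P : D.Surface} {R : D.Region}
    (hP : P ∈ D.regionCurve R) : D.height P = 0 := by
  obtain ⟨d, t, h, rfl, hh, -⟩ := hP
  exact hh

/-! ## The intersections of the `β` curves with the plane of the diagram -/

/-- The two bounds on `level` keep the silhouette strictly below the plane away from its ends. -/
lemma half_lt_level (T : Set X) (c : X) : 1 / 2 < D.level T c := by
  unfold level
  have : (0 : ℝ) < 1 / (2 * ((D.farSide T c).ncard + 2)) := by positivity
  linarith

lemma level_lt_one (T : Set X) (c : X) : D.level T c < 1 := by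
  unfold level
  have : (1 : ℝ) / (2 * ((D.farSide T c).ncard + 2)) < 1 / 2 := by
    apply one_div_lt_one_div_of_lt (by norm_num)
    have : (0 : ℝ) ≤ (D.farSide T c).ncard := by positivity
    linarith
  linarith

lemma eq_cornerPoint_of_mem_meridian {P : D.Surface} (hP : P ∈ D.meridian)
    (h0 : D.height P = 0) : ∃ j : ZMod 2, P = D.cornerPoint (Sum.inr j) := by
  obtain ⟨j, t, h, rfl, ht⟩ := hP
  exact ⟨j, (D.pt_eq_cornerPoint_iff).2 ⟨rfl, ht, h0⟩⟩

lemma eq_cornerPoint_of_mem_topArcs {c : X} {P : D.Surface} (hP : P ∈ D.topArcs c)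
    (h0 : D.height P = 0) : ∃ k : ZMod 4, P = D.cornerPoint (Sum.inl (c, k)) := by
  obtain ⟨k, t, h, rfl, hh, -⟩ := hP
  rw [height_pt] at h0
  have ht : (t : ℝ) = 0 := abs_eq_zero.1 (by linarith)
  exact ⟨k, (D.pt_eq_cornerPoint_iff).2 ⟨rfl, ht, h0⟩⟩

lemma eq_cornerPoint_of_mem_edgeArc {T : Set X} {c : X} {P : D.Surface}
    (hP : P ∈ D.edgeArc T c) (h0 : D.height P = 0) :
    ∃ k : ZMod 4, P = D.cornerPoint (Sum.inl (c, k)) := by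
  obtain ⟨k, t, h, rfl, ht, -⟩ := hP
  exact ⟨k, (D.pt_eq_cornerPoint_iff).2 ⟨rfl, ht, h0⟩⟩

lemma eq_cornerPoint_of_mem_silhouette {T : Set X} {c : X} {P : D.Surface}
    (hP : P ∈ D.silhouette T c) (h0 : D.height P = 0) :
    ∃ k : ZMod 4, P = D.cornerPoint (Sum.inl (c, k)) := by
  obtain ⟨c', k, d, t, h, -, -, rfl, H⟩ := hP
  rw [height_pt] at h0
  have hl := D.half_lt_level T c
  have hl' := D.level_lt_one T c
  have ht : |(t : ℝ)| ≤ 1 := abs_le.2 t.2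
  have ht' := abs_nonneg (t : ℝ)
  rcases H with ⟨rfl, side, H⟩ | ⟨-, -, -, H⟩ | ⟨-, ⟨-, -, H⟩ | ⟨-, -, H⟩⟩
  -- On the end segments the slope `1 - l` is nonzero, so `h = 0` only at the corner point `t = 0`.
  · have hz : (1 - D.level T c') * |(t : ℝ)| = 0 := by linarith
    have hz' : (t : ℝ) = 0 :=
      abs_eq_zero.1 ((mul_eq_zero.1 hz).resolve_left (by linarith))
    rcases side with ⟨hd, -⟩ | ⟨hd, -⟩
    · exact ⟨k + 1, (D.pt_eq_cornerPoint_iff).2 ⟨hd, hz', h0⟩⟩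
    · exact ⟨k - 1, (D.pt_eq_cornerPoint_iff).2 ⟨hd, hz', h0⟩⟩
  -- On the other pieces `h + 1` is at most `l` or `1 - l`, both less than `1`.
  all_goals linarith

lemma eq_cornerPoint_of_mem_betaCurve_some {T : Set X} {c : X} {P : D.Surface}
    (hP : P ∈ D.betaCurve T (some c)) (h0 : D.height P = 0) :
    ∃ k : ZMod 4, P = D.cornerPoint (Sum.inl (c, k)) := by
  rcases hP with (hP | hP) | hP
  · exact D.eq_cornerPoint_of_mem_topArcs hP h0
  · exact D.eq_cornerPoint_of_mem_edgeArc hP h0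
  · exact D.eq_cornerPoint_of_mem_silhouette hP h0

lemma cornerPoint_mem_meridian (j : ZMod 2) : D.cornerPoint (Sum.inr j) ∈ D.meridian :=
  ⟨j, _, _, rfl, rfl⟩

/-- The top arcs alone already end in all four corners, whatever `T` is. -/
lemma cornerPoint_mem_betaCurve_some (T : Set X) (c : X) (k : ZMod 4) :
    D.cornerPoint (Sum.inl (c, k)) ∈ D.betaCurve T (some c) := by
  refine Or.inl (Or.inl ⟨k, _, _, rfl, by simp, ?_⟩)
  have hk : (k = 0 ∨ k = 2) ∨ (k = 1 ∨ k = 3) := by revert k; decide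
  exact hk.imp (fun h => ⟨h, le_rfl⟩) fun h => ⟨h, le_rfl⟩

/-! ## The marked regions -/

/-- Regions are orbits of `faceNext`, which preserves the colour; the induction is on the integer
exponent, in both directions. -/
lemma color_eq_of_region_eq {d d' : Dart X} (h : D.region d = D.region d') :
    D.color d = D.color d' := by
  obtain ⟨n, rfl⟩ : (faceNext D.flip).SameCycle d d' := Quotient.exact h
  have hinv (e : Dart X) : D.color ((faceNext D.flip)⁻¹ e) = D.color e := by
    simpa using (D.color_faceNext ((faceNext D.flip)⁻¹ e)).symm
  induction n with
  | zero => simp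
  | succ n ih =>
    rw [add_comm, zpow_add, zpow_one, Equiv.Perm.mul_apply, D.color_faceNext]
    exact ih (Quotient.sound ⟨n, rfl⟩)
  | pred n ih =>
    rw [sub_eq_neg_add, zpow_add, zpow_neg_one, Equiv.Perm.mul_apply, hinv]
    exact ih (Quotient.sound ⟨_, rfl⟩)

lemma color_inr_one : D.color (Sum.inr 1) = !D.color (Sum.inr 0) := D.color_rot (Sum.inr 0)

lemma color_rootCorner (χ : Bool) : D.color (D.rootCorner χ) = χ := by
  unfold rootCorner
  split_ifs with h
  · exact h
  · rw [color_inr_one]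
    revert h
    cases D.color (Sum.inr 0) <;> cases χ <;> simp

lemma inr_eq_rootCorner (j : ZMod 2) : Sum.inr j = D.rootCorner (D.color (Sum.inr j)) := by
  have hj : j = 0 ∨ j = 1 := by revert j; decide
  rcases hj with rfl | rfl
  · simp [rootCorner]
  · simp [rootCorner, color_inr_one]

lemma exists_rootCorner_eq_inr (χ : Bool) : ∃ j : ZMod 2, D.rootCorner χ = Sum.inr j := by
  unfold rootCorner
  split_ifs
  exacts [⟨0, rfl⟩, ⟨1, rfl⟩]

lemma root_true_ne_root_false : D.root true ≠ D.root false := fun h => by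
  simpa [color_rootCorner] using D.color_eq_of_region_eq h

/-- This singles out the intersection point on `β_p`: of the two corners at `p`, the white one lies
in the region without an `α` curve. -/
lemma inr_eq_rootCorner_true {j : ZMod 2} (h : D.region (Sum.inr j) ≠ D.root false) :
    Sum.inr j = D.rootCorner true := by
  have hj := D.inr_eq_rootCorner j
  cases hc : D.color (Sum.inr j) <;> rw [hc] at hj
  · exact absurd (congrArg D.region hj) h
  · exact hj

/-! ## Generators and Kauffman states -/

namespace KauffmanState

variable {D}

lemma ext_corner {x y : D.KauffmanState} (h : x.corner = y.corner) : x = y := by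
  cases x
  cases y
  cases h
  rfl

/-- The corners occupied by a state, including the marked black one, indexed by the `β` curves. -/
def occupied (x : D.KauffmanState) : Option X → Dart X
  | none => D.rootCorner true
  | some c => Sum.inl (c, x.corner c)

/-- The unordered tuple of points on the surface given by a state. -/
def toSym (x : D.KauffmanState) : Sym D.Surface D.genus :=
  ⟨Finset.univ.val.map fun o => D.cornerPoint (x.occupied o), by simp [genus]⟩

lemma coe_toSym (x : D.KauffmanState) : (x.toSym : Multiset D.Surface) =
    D.cornerPoint (D.rootCorner true) ::ₘ
      Finset.univ.val.map fun c : X => D.cornerPoint (Sum.inl (c, x.corner c)) := by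
  change Finset.univ.val.map (fun o => D.cornerPoint (x.occupied o)) = _
  simp [univ_option, Finset.insertNone, occupied]

/-- A corner point remembers its crossing, so the unordered tuple determines which entry belongs to
which `β` curve. -/
lemma toSym_injective : Function.Injective (toSym (D := D)) := by
  intro x y h
  refine ext_corner (funext fun c => ?_)
  have hmem : D.cornerPoint (x.occupied (some c)) ∈ (y.toSym : Multiset D.Surface) := by
    rw [← h]
    exact Multiset.mem_map_of_mem _ (Finset.mem_univ (some c))
  obtain ⟨o, -, ho⟩ := Multiset.mem_map.1 hmem
  have ho' := D.cornerPoint_injective ho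
  cases o with
  | none =>
    obtain ⟨j, hj⟩ := D.exists_rootCorner_eq_inr true
    simp [occupied, hj] at ho'
  | some c' =>
    simp only [occupied, Sum.inl.injEq, Prod.mk.injEq] at ho'
    obtain ⟨rfl, hk⟩ := ho'
    exact hk.symm

/-- The black root corner supplies the one region that carries an `α` curve but is missed by the
state. -/
lemma region_occupied_bijective (x : D.KauffmanState) :
    Function.Injective (fun o => D.region (x.occupied o)) ∧
      Set.range (fun o => D.region (x.occupied o)) = {R | R ≠ D.root false} := by
  have hmaps (c : X) := x.bijOn.mapsTo (Set.mem_univ c)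
  constructor
  · rintro (_ | c) (_ | c') h
    · rfl
    · exact absurd h.symm (hmaps c').1
    · exact absurd h (hmaps c).1
    · exact congrArg some (x.bijOn.injOn (Set.mem_univ _) (Set.mem_univ _) h)
  · ext R
    constructor
    · rintro ⟨_ | c, rfl⟩
      · exact D.root_true_ne_root_false
      · exact (hmaps c).2
    · intro hR
      by_cases hR' : R = D.root true
      · exact ⟨none, hR'.symm⟩
      · obtain ⟨c, -, hc⟩ := x.bijOn.surjOn ⟨hR', hR⟩
        exact ⟨some c, hc⟩

lemma toSym_mem_generators (x : D.KauffmanState) (T : Set X) : x.toSym ∈ D.generators T := by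
  obtain ⟨hinj, hrange⟩ := x.region_occupied_bijective
  constructor
  -- The state matches `β` curves with `α` curves; reindexing along this matching exhibits the same
  -- tuple as a point of `𝕋_α`.
  · let e : Option X ≃ D.AlphaIndex := Equiv.ofBijective
      (fun o => ⟨D.region (x.occupied o), hrange.subset ⟨o, rfl⟩⟩)
      ⟨fun o o' h => hinj (congrArg Subtype.val h), fun R => by
        obtain ⟨o, ho⟩ := hrange.superset R.2
        exact ⟨o, Subtype.ext ho⟩⟩
    refine ⟨fun R => D.cornerPoint (x.occupied (e.symm R)), fun R => ?_, ?_⟩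
    · exact (D.cornerPoint_mem_regionCurve_iff).2 (congrArg Subtype.val (e.apply_symm_apply R))
    · change Finset.univ.val.map (fun o => D.cornerPoint (x.occupied o)) = _
      rw [← Finset.map_univ_equiv e.symm, Finset.map_val, Multiset.map_map]
      rfl
  · refine ⟨fun o => D.cornerPoint (x.occupied o), ?_, rfl⟩
    rintro (_ | c)
    · obtain ⟨j, hj⟩ := D.exists_rootCorner_eq_inr true
      simp only [occupied, hj]
      exact D.cornerPoint_mem_meridian j
    · exact D.cornerPoint_mem_betaCurve_some T c _

end KauffmanState

lemma exists_toSym_eq_of_mem_generators {T : Set X} {z : Sym D.Surface D.genus}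
    (hz : z ∈ D.generators T) : ∃ x : D.KauffmanState, x.toSym = z := by
  obtain ⟨⟨p, hp, hpz⟩, ⟨q, hq, hqz⟩⟩ := hz
  -- Each point chosen on a `β` curve also occurs among those chosen on the `α` curves.
  have hq0 (o : Option X) : D.height (q o) = 0 := by
    have hmem : q o ∈ (z : Multiset D.Surface) := by
      rw [hqz]
      exact Multiset.mem_map_of_mem _ (Finset.mem_univ o)
    rw [hpz] at hmem
    obtain ⟨R, -, hR⟩ := Multiset.mem_map.1 hmem
    rw [← hR]
    exact D.height_eq_zero_of_mem_regionCurve (hp R)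
  obtain ⟨j, hj⟩ := D.eq_cornerPoint_of_mem_meridian (hq none) (hq0 none)
  choose k hk using fun c => D.eq_cornerPoint_of_mem_betaCurve_some (hq (some c)) (hq0 (some c))
  let e : Option X → Dart X := fun o => o.elim (Sum.inr j) fun c => Sum.inl (c, k c)
  have he (o : Option X) : q o = D.cornerPoint (e o) := by
    cases o
    exacts [hj, hk _]
  have hpe (R : D.AlphaIndex) : ∃ d, p R = D.cornerPoint d := by
    have hmem : p R ∈ (z : Multiset D.Surface) := by
      rw [hpz]
      exact Multiset.mem_map_of_mem _ (Finset.mem_univ R)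
    rw [hqz] at hmem
    obtain ⟨o, -, ho⟩ := Multiset.mem_map.1 hmem
    exact ⟨e o, by rw [← ho, he]⟩
  choose a ha using hpe
  have hregion (R : D.AlphaIndex) : D.region (a R) = R := by
    have := hp R
    rw [ha] at this
    exact (D.cornerPoint_mem_regionCurve_iff).1 this
  have hdarts : Finset.univ.val.map a = Finset.univ.val.map e := by
    apply Multiset.map_injective D.cornerPoint_injective
    simp only [Multiset.map_map, Function.comp_def, ← ha, ← he]
    exact hpz.symm.trans hqz
  -- The left side lists each region other than the marked white one exactly once. Injectivity,
  -- range and surjectivity of the region map on chosen corners are all read off from this equality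
  -- of multisets.
  have hregions : (Finset.univ : Finset D.AlphaIndex).val.map Subtype.val =
      Finset.univ.val.map fun o => D.region (e o) := by
    have := congrArg (Multiset.map D.region) hdarts
    simpa only [Multiset.map_map, Function.comp_def, hregion] using this
  have hinj : Function.Injective fun o => D.region (e o) := fun o o' h =>
    Multiset.inj_on_of_nodup_map
      (hregions ▸ Finset.univ.nodup.map Subtype.val_injective) o (Finset.mem_univ o) o'
      (Finset.mem_univ o') h
  have hne (o : Option X) : D.region (e o) ≠ D.root false := by
    have hmem := Multiset.mem_map_of_mem (fun o => D.region (e o)) (Finset.mem_univ_val o)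
    rw [← hregions] at hmem
    obtain ⟨R, -, hR⟩ := Multiset.mem_map.1 hmem
    exact hR ▸ R.2
  have hsurj (R : D.AlphaIndex) : ∃ o, D.region (e o) = R := by
    have hmem := Multiset.mem_map_of_mem (Subtype.val : D.AlphaIndex → D.Region)
      (Finset.mem_univ_val R)
    rw [hregions] at hmem
    obtain ⟨o, -, ho⟩ := Multiset.mem_map.1 hmem
    exact ⟨o, ho⟩
  have hroot : e none = D.rootCorner true := D.inr_eq_rootCorner_true (hne none)
  have hroot' : D.region (e none) = D.root true := congrArg D.region hroot
  let x : D.KauffmanState :=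
    { corner := k
      bijOn := by
        refine ⟨fun c _ => ⟨fun h => ?_, hne (some c)⟩, fun c _ c' _ h => ?_, ?_⟩
        · exact Option.some_ne_none c (hinj (h.trans hroot'.symm))
        · exact Option.some_injective _ (hinj h)
        · rintro R ⟨hR, hR'⟩
          obtain ⟨_ | c, ho⟩ := hsurj ⟨R, hR'⟩
          · exact absurd (ho.symm.trans hroot') hR
          · exact ⟨c, Set.mem_univ c, ho⟩ }
  have hx : x.occupied = e := by
    funext o
    cases o
    exacts [hroot.symm, rfl]
  refine ⟨x, Subtype.ext ?_⟩
  change Finset.univ.val.map (fun o => D.cornerPoint (x.occupied o)) = (z : Multiset D.Surface)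
  simp only [hx, hqz, ← he]

end MarkedDiagram

theorem proposition3p3 {X : Type*} [Fintype X] (D : MarkedDiagram X) (T : Set X)
    (hT : D.IsSpanningTree T) :
    ∃ Φ : D.KauffmanState ≃ D.generators T, ∀ x : D.KauffmanState,
      ((Φ x : Sym D.Surface D.genus) : Multiset D.Surface) =
        D.cornerPoint (D.rootCorner true) ::ₘ
          Finset.univ.val.map fun c : X => D.cornerPoint (Sum.inl (c, x.corner c)) := by
  refine ⟨Equiv.ofBijective (fun x => ⟨x.toSym, x.toSym_mem_generators T⟩)
    ⟨fun x y h => MarkedDiagram.KauffmanState.toSym_injective (congrArg Subtype.val h),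
      fun z => ?_⟩, fun x => x.coe_toSym⟩
  obtain ⟨x, hx⟩ := D.exists_toSym_eq_of_mem_generators z.2
  exact ⟨x, Subtype.ext hx⟩
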